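/- Let $n\ge 0$ be an integer, let $S=\mathbb{C}[x_{ij}\mid 1\le j<i\le n]$, and let $F=S^{\binom n3}$ be the free $S$-module with basis $\{r_{ijk}\mid 1\le k<j<i\le n\}$. For $1\le k<j<i\le n$, let $\mathcal{B}_{ijk}\subset F$ be the set of the following elements: $$(-x_{jk}-x_{lk})\,r_{ijl}+x_{jl}\,r_{ijk},\qquad x_{jk}\,r_{ijl}+x_{il}\,r_{ijk},\qquad x_{lk}\,r_{ijk}\qquad (k<l<j);$$ $$-x_{jk}\,r_{ilj}+x_{il}\,r_{ijk},\qquad x_{lk}\,r_{ijk},\qquad x_{lj}\,r_{ijk}\qquad (j<l<i);$$ $$x_{jk}\,r_{lij}+x_{li}\,r_{ijk},\qquad x_{lk}\,r_{ijk},\qquad x_{lj}\,r_{ijk}\qquad (i<l\le n);$$ $$(x_{il}+x_{jl}+x_{kl})\,r_{ijk}\quad (1\le l<k);\qquad (x_{ik}+x_{jk})\,r_{ijk};\qquad x_{st}\,r_{ijk}\quad (1\le t<s\le n,\ \{s,t\}\cap\{i,j,k\}=\emptyset).$$ Put $\mathcal{B}=\bigcup_{1\le k<j<i\le n}\mathcal{B}_{ijk}$,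 and let $\Psi\colon S^{\mathcal{B}}\to F$ be the $S$-linear map from the free $S$-module on the set $\mathcal{B}$ that sends each basis element to the corresponding element of $\mathcal{B}$. Let $$\mathcal{D}_{ijk}=\{x_{kl}x_{kp}\,r_{ijk}\mid 1\le p\le l<k\}\cup\{x_{jq}x_{kp}\,r_{ijk}\mid 1\le p<k,\ 1\le q\le k\}.$$ Order the variables by $x_{st}\succ x_{kl}$ if $s>k$, or $s=k$ and $t>l$. Order the monomials of $S$ by the graded reverse lexicographic order: $\mathbf{x}^\alpha\succ\mathbf{x}^\beta$ if $\deg\mathbf{x}^\alpha>\deg\mathbf{x}^\beta$, or the degrees agree and the nonzero entry of $\alpha-\beta$ belonging to the smallest variable is negative. Order the basis of $F$ by $r_{lst}\succ r_{ijk}$ if $i>l$, or $i=l$ and $j>s$, or $i=l$, $j=s$ and $k>t$. Finally, order the monomials of $F$ by $\mathbf{x}^\alpha r_{lst}\succ\mathbf{x}^\beta r_{ijk}$ if $r_{lst}\succ r_{ijk}$, or $r_{lst}=r_{ijk}$ and $\mathbf{x}^\alpha\succ\mathbf{x}^\beta$. Then, with respect to this monomial order, the finite set $$\mathcal{G}=\bigcup_{1\le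 k<j<i\le n}(\mathcal{B}_{ijk}\cup\mathcal{D}_{ijk})$$ is a Gröbner basis of the submodule $\operatorname{im}(\Psi)\subset F$; that is, $\mathcal{G}$ generates $\operatorname{im}(\Psi)$, and the initial terms of the elements of $\mathcal{G}$ generate the submodule of $F$ generated by the initial terms of all elements of $\operatorname{im}(\Psi)$. -/

import Mathlib

/-! ### Gröbner bases of submodules of a free module over a polynomial ring

A monomial `x^α e_t` of the free module `ι →₀ MvPolynomial σ R` is encoded by the pair `(t, α)`. -/

/-- A monomial order on the free module with basis indexed by `ι` over a polynomial ring with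
variables `σ`; `lt m m'` means `m ≺ m'`. -/
structure ModuleMonomialOrder (σ ι : Type*) where
  lt : ι × (σ →₀ ℕ) → ι × (σ →₀ ℕ) → Prop
  irrefl : ∀ m, ¬ lt m m
  trans : ∀ m₁ m₂ m₃, lt m₁ m₂ → lt m₂ m₃ → lt m₁ m₃
  total : ∀ m₁ m₂, m₁ ≠ m₂ → lt m₁ m₂ ∨ lt m₂ m₁
  mul_lt : ∀ m₁ m₂ : ι × (σ →₀ ℕ), lt m₂ m₁ → ∀ s : σ →₀ ℕ, s ≠ 0 →
    lt (m₂.1, s + m₂.2) (m₁.1, s + m₁.2) ∧ lt m₂ (m₂.1, s + m₂.2)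

namespace ModuleMonomialOrder

variable {σ ι R : Type*} [CommRing R]

/-- `g` is the initial term of `f`, i.e. the largest term of `f` (the zero element has none). -/
def IsInitialTerm (ord : ModuleMonomialOrder σ ι) (f g : ι →₀ MvPolynomial σ R) : Prop :=
  ∃ (t : ι) (α : σ →₀ ℕ), MvPolynomial.coeff α (f t) ≠ 0 ∧
    (∀ (s : ι) (β : σ →₀ ℕ), MvPolynomial.coeff β (f s) ≠ 0 → (s, β) ≠ (t, α) →
      ord.lt (s, β) (t, α)) ∧
    g = Finsupp.single t (MvPolynomial.monomial α (MvPolynomial.coeff α (f t)))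

/-- The submodule generated by the initial terms of the elements of a set `A`. -/
noncomputable def initialSubmodule (ord : ModuleMonomialOrder σ ι) (A : Set (ι →₀ MvPolynomial σ R)) :
    Submodule (MvPolynomial σ R) (ι →₀ MvPolynomial σ R) :=
  Submodule.span (MvPolynomial σ R) {g | ∃ f ∈ A, ord.IsInitialTerm f g}

/-- A finite set `G` is a Gröbner basis of the submodule `M` if `G` generates `M` and the initial
terms of the elements of `G` generate the submodule generated by all initial terms of elements
of `M`. -/
def IsGroebnerBasis (ord : ModuleMonomialOrder σ ι) (G : Set (ι →₀ MvPolynomial σ R))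
    (M : Submodule (MvPolynomial σ R) (ι →₀ MvPolynomial σ R)) : Prop :=
  G.Finite ∧ Submodule.span (MvPolynomial σ R) G = M ∧
    ord.initialSubmodule G = ord.initialSubmodule (M : Set (ι →₀ MvPolynomial σ R))

end ModuleMonomialOrder

namespace UpperMcCool

/-! ### The polynomial ring and the free module

The indices `1, …, n` are represented by the elements of `Fin n`; only their order matters. -/

/-- Indices `(i, j)`, `j < i`, of the variables `x_{ij}`. -/
@[ext] structure Pair (n : ℕ) where
  i : Fin n
  j : Fin n
  hji : j < i

/-- Indices `(i, j, k)`, `k < j < i`, of the basis elements `r_{ijk}`. -/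
@[ext] structure Triple (n : ℕ) where
  i : Fin n
  j : Fin n
  k : Fin n
  hkj : k < j
  hji : j < i

instance (n : ℕ) : Finite (Pair n) :=
  Finite.of_injective (fun v : Pair n => (v.i, v.j)) (by
    intro v w h
    simp only [Prod.mk.injEq] at h
    exact Pair.ext h.1 h.2)

/-- The polynomial ring `S = ℂ[x_{ij} | j < i]`. -/
abbrev S (n : ℕ) : Type := MvPolynomial (Pair n) ℂ

/-- The free `S`-module of rank `n choose 3` with basis `r_{ijk}`, `k < j < i`. -/
abbrev F (n : ℕ) : Type := Triple n →₀ S n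

variable {n : ℕ}

/-- The variable `x_{ij}`. -/
noncomputable def x (i j : Fin n) (hji : j < i := by order) : S n :=
  MvPolynomial.X ⟨i, j, hji⟩

/-- The basis element `r_{ijk}`. -/
noncomputable def r (i j k : Fin n) (hkj : k < j := by order) (hji : j < i := by order) : F n :=
  Finsupp.single ⟨i, j, k, hkj, hji⟩ 1

/-! ### The term order -/

/-- `x_{kl} ≺ x_{st}` iff `s > k`, or `s = k` and `t > l`. -/
def varLT (v w : Pair n) : Prop :=
  w.i > v.i ∨ (w.i = v.i ∧ w.j > v.j)

/-- `r_{ijk} ≺ r_{lst}` iff `i > l`, or `i = l` and `j > s`, or `i = l`, `j = s` and `k > t`. -/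
def basisLT (a b : Triple n) : Prop :=
  a.i > b.i ∨ (a.i = b.i ∧ a.j > b.j) ∨ (a.i = b.i ∧ a.j = b.j ∧ a.k > b.k)

/-- Graded reverse lexicographic order: `x^β ≺ x^α` iff `deg x^β < deg x^α`, or the degrees agree
and the entry of `α - β` at the smallest variable where it does not vanish is negative. -/
def grevlexLT (β α : Pair n →₀ ℕ) : Prop :=
  β.degree < α.degree ∨
    (β.degree = α.degree ∧ ∃ v, α v < β v ∧ ∀ w, varLT w v → α w = β w)

/-- Position over grevlex: `x^β r_{ijk} ≺ x^α r_{lst}` iff `r_{ijk} ≺ r_{lst}`, or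
`r_{ijk} = r_{lst}` and `x^β ≺ x^α`. -/
def posGrevlexLT (m m' : Triple n × (Pair n →₀ ℕ)) : Prop :=
  basisLT m.1 m'.1 ∨ (m.1 = m'.1 ∧ grevlexLT m.2 m'.2)

theorem varLT_irrefl (v : Pair n) : ¬ varLT v v := by
  simp [varLT]

theorem varLT_trans {u v w : Pair n} (h : varLT u v) (h' : varLT v w) : varLT u w := by
  unfold varLT at *; omega

theorem varLT_total (v w : Pair n) (h : v ≠ w) : varLT v w ∨ varLT w v := by
  have : ¬ (v.i = w.i ∧ v.j = w.j) := fun h' => h (Pair.ext h'.1 h'.2)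
  unfold varLT; omega

theorem basisLT_irrefl (a : Triple n) : ¬ basisLT a a := by
  simp [basisLT]

theorem basisLT_trans {a b c : Triple n} (h : basisLT a b) (h' : basisLT b c) : basisLT a c := by
  unfold basisLT at *; omega

theorem basisLT_total (a b : Triple n) (h : a ≠ b) : basisLT a b ∨ basisLT b a := by
  have : ¬ (a.i = b.i ∧ a.j = b.j ∧ a.k = b.k) := fun h' => h (Triple.ext h'.1 h'.2.1 h'.2.2)
  unfold basisLT; omega

theorem grevlexLT_irrefl (α : Pair n →₀ ℕ) : ¬ grevlexLT α α := by
  simp [grevlexLT]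

theorem grevlexLT_trans {α β γ : Pair n →₀ ℕ} (h : grevlexLT α β) (h' : grevlexLT β γ) :
    grevlexLT α γ := by
  rcases h with h | ⟨h, v, hv, hw⟩ <;> rcases h' with h' | ⟨h', v', hv', hw'⟩
  · exact Or.inl (by omega)
  · exact Or.inl (by omega)
  · exact Or.inl (by omega)
  · refine Or.inr ⟨by omega, ?_⟩
    rcases eq_or_ne v v' with rfl | hne
    · exact ⟨v, by omega, fun w h => (hw' w h).trans (hw w h)⟩
    rcases varLT_total v v' hne with hlt | hlt
    · exact ⟨v, by rw [hw' v hlt]; exact hv,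
        fun w h => (hw' w (varLT_trans h hlt)).trans (hw w h)⟩
    · exact ⟨v', by rw [← hw v' hlt]; exact hv',
        fun w h => (hw' w h).trans (hw w (varLT_trans h hlt))⟩

theorem grevlexLT_total (α β : Pair n →₀ ℕ) (h : α ≠ β) : grevlexLT α β ∨ grevlexLT β α := by
  rcases lt_trichotomy α.degree β.degree with hd | hd | hd
  · exact Or.inl (Or.inl hd)
  · have : Std.Irrefl (varLT (n := n)) := ⟨varLT_irrefl⟩
    have : IsTrans (Pair n) varLT := ⟨fun _ _ _ => varLT_trans⟩
    have wf : WellFounded (varLT (n := n)) := Finite.wellFounded_of_trans_of_irrefl _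
    have hne : {v | α v ≠ β v}.Nonempty := by
      by_contra hc
      rw [Set.not_nonempty_iff_eq_empty, Set.eq_empty_iff_forall_notMem] at hc
      exact h (Finsupp.ext fun v => not_not.mp (hc v))
    have hmin : ∀ w, varLT w (wf.min _ hne) → α w = β w := fun w hw =>
      not_not.mp fun hc => wf.not_lt_min {v | α v ≠ β v} hc hw
    rcases lt_or_gt_of_ne (wf.min_mem _ hne) with hlt | hlt
    · exact Or.inr (Or.inr ⟨hd.symm, _, hlt, hmin⟩)
    · exact Or.inl (Or.inr ⟨hd, _, hlt, fun w hw => (hmin w hw).symm⟩)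
  · exact Or.inr (Or.inl hd)

/-- The position-over-grevlex monomial order on `F n`. -/
def posGrevlex (n : ℕ) : ModuleMonomialOrder (Pair n) (Triple n) where
  lt := posGrevlexLT
  irrefl := by
    rintro m (h | ⟨-, h⟩)
    · exact basisLT_irrefl _ h
    · exact grevlexLT_irrefl _ h
  trans := by
    rintro ⟨a, α⟩ ⟨b, β⟩ ⟨c, γ⟩ (h | ⟨rfl, h⟩) (h' | ⟨rfl, h'⟩)
    · exact Or.inl (basisLT_trans h h')
    · exact Or.inl h
    · exact Or.inl h'
    · exact Or.inr ⟨rfl, grevlexLT_trans h h'⟩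
  total := by
    rintro ⟨a, α⟩ ⟨b, β⟩ h
    by_cases hab : a = b
    · subst hab
      exact (grevlexLT_total α β fun e => h (by rw [e])).imp
        (fun h => Or.inr ⟨rfl, h⟩) (fun h => Or.inr ⟨rfl, h⟩)
    · exact (basisLT_total a b hab).imp Or.inl Or.inl
  mul_lt := by
    rintro ⟨a, α⟩ ⟨b, β⟩ h s hs
    refine ⟨?_, Or.inr ⟨rfl, Or.inl ?_⟩⟩
    · rcases h with h | ⟨h, hd | ⟨hd, v, hv, hw⟩⟩
      · exact Or.inl h
      · refine Or.inr ⟨h, Or.inl ?_⟩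
        simpa [map_add] using hd
      · refine Or.inr ⟨h, Or.inr ⟨?_, v, ?_, ?_⟩⟩
        · simpa [map_add] using hd
        · simpa using hv
        · intro w h
          simpa using hw w h
    · have : s.degree ≠ 0 := by simpa [Finsupp.degree_eq_zero_iff] using hs
      have h0 : 0 < s.degree := Nat.pos_of_ne_zero this
      simpa [map_add] using h0

/-! ### The generators, the map `Ψ` and the candidate Gröbner basis -/

/-- Membership in the set `ℬ_{ijk}`. -/
inductive MemB (i j k : Fin n) (hkj : k < j) (hji : j < i) : F n → Prop
  | g₁ (l : Fin n) (_ : k < l) (_ : l < j) :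
      MemB i j k hkj hji ((-x j k - x l k) • r i j l + x j l • r i j k)
  | g₂ (l : Fin n) (_ : k < l) (_ : l < j) :
      MemB i j k hkj hji (x j k • r i j l + x i l • r i j k)
  | g₃ (l : Fin n) (_ : j < l) (_ : l < i) :
      MemB i j k hkj hji (-x j k • r i l j + x i l • r i j k)
  | g₄ (l : Fin n) (_ : i < l) :
      MemB i j k hkj hji (x j k • r l i j + x l i • r i j k)
  | h₁ (l : Fin n) (_ : l < k) :
      MemB i j k hkj hji ((x i l + x j l + x k l) • r i j k)
  | h₂ : MemB i j k hkj hji ((x i k + x j k) • r i j k)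
  | h₃ (l : Fin n) (_ : k < l) (_ : l < j) : MemB i j k hkj hji (x l k • r i j k)
  | h₄ (l : Fin n) (_ : j < l) (_ : l < i) : MemB i j k hkj hji (x l k • r i j k)
  | h₅ (l : Fin n) (_ : j < l) (_ : l < i) : MemB i j k hkj hji (x l j • r i j k)
  | h₆ (l : Fin n) (_ : i < l) : MemB i j k hkj hji (x l k • r i j k)
  | h₇ (l : Fin n) (_ : i < l) : MemB i j k hkj hji (x l j • r i j k)
  | h₈ (s t : Fin n) (_ : t < s) (_ : ({s, t} ∩ {i, j, k} : Set (Fin n)) = ∅) :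
      MemB i j k hkj hji (x s t • r i j k)

/-- Membership in the set `𝒟_{ijk}` of quadratic elements. -/
inductive MemD (i j k : Fin n) (hkj : k < j) (hji : j < i) : F n → Prop
  | h₉ (l p : Fin n) (_ : p ≤ l) (_ : l < k) :
      MemD i j k hkj hji ((x k l * x k p) • r i j k)
  | h₀ (q p : Fin n) (_ : q ≤ k) (_ : p < k) :
      MemD i j k hkj hji ((x j q * x k p) • r i j k)

/-- `ℬ`, the union of the sets `ℬ_{ijk}`. -/
def setB (n : ℕ) : Set (F n) :=
  {f | ∃ (i j k : Fin n) (hkj : k < j) (hji : j < i), MemB i j k hkj hji f}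

/-- `𝒢`, the union of the sets `ℬ_{ijk} ∪ 𝒟_{ijk}`. -/
def setG (n : ℕ) : Set (F n) :=
  {f | ∃ (i j k : Fin n) (hkj : k < j) (hji : j < i),
    MemB i j k hkj hji f ∨ MemD i j k hkj hji f}

/-- The `S`-linear map `Ψ` from the free `S`-module on the set `ℬ` to `F n`, sending each
generator to the corresponding element of `ℬ`. -/
noncomputable def Psi (n : ℕ) : (setB n →₀ S n) →ₗ[S n] F n :=
  Finsupp.linearCombination (S n) (Subtype.val : setB n → F n)

end UpperMcCool

namespace UpperMcCool

open MvPolynomial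

variable {n : ℕ}

/-! The quadratic elements of 𝒟 lie in im Ψ because multiplication by x_{kp} carries r_{ijk}, modulo
ℬ, to x_{ij} r_{ikp} and to -x_{ij} r_{jkp}, and most variables annihilate those basis elements
(`MemD.mem_span`).

No S-pairs are reduced. Instead, monomials outside the span of the initial terms of 𝒢 are shown not
to lead any element of im Ψ. At r_{ijk} the linear initial terms are all variables except x_{ij},
x_{jq} with q ≤ k, and x_{kp} (`exists_isInitialTerm_X`). With the quadratic ones x_{kl}x_{kp} and
x_{jq}x_{kp}, two kinds of monomials remain: products of x_{ij} and the x_{jq}, q ≤ k; and x_{ij}^m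
x_{kp}.

Each kind is excluded by an additive map F → S that vanishes on im Ψ but would be nonzero on an
element with such a leading term. For the first kind it is `localMap`, semilinear over a
substitution that never increases monomials (`exists_of_leading`). For the second it is `quadMap`,
built from first-order derivatives along the line where only x_{ij} survives
(`coeff_eq_zero_of_leading`). `exists_dvd_leading` combines the two. -/

theorem range_Psi (n : ℕ) : LinearMap.range (Psi n) = Submodule.span (S n) (setB n) := by
  rw [Psi, Finsupp.range_linearCombination, Subtype.range_coe]

/-! ### The quadratic elements lie in im Ψ -/

theorem MemB.mem_span {i j k : Fin n} {hkj : k < j} {hji : j < i} {f : F n}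
    (h : MemB i j k hkj hji f) : f ∈ Submodule.span (S n) (setB n) :=
  Submodule.subset_span ⟨i, j, k, hkj, hji, h⟩

/-- Multiplication by `x_{kp}` moves `r_{ijk}` to `x_{ij} r_{ikp}` modulo `ℬ`. -/
theorem smul_r_sub_mem {i j k p : Fin n} (hpk : p < k) (hkj : k < j) (hji : j < i) :
    x k p • r i j k - x i j • r i k p ∈ Submodule.span (S n) (setB n) := by
  have h := (MemB.g₃ (i := i) (j := k) (k := p) (hkj := hpk) (hji := hkj.trans hji) j hkj
    hji).mem_span
  convert Submodule.neg_mem _ h using 1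
  module

/-- Multiplication by `x_{kp}` moves `r_{ijk}` to `-x_{ij} r_{jkp}` modulo `ℬ`. -/
theorem smul_r_add_mem {i j k p : Fin n} (hpk : p < k) (hkj : k < j) (hji : j < i) :
    x k p • r i j k + x i j • r j k p ∈ Submodule.span (S n) (setB n) :=
  (MemB.g₄ (i := j) (j := k) (k := p) (hkj := hpk) (hji := hkj) i hji).mem_span

/-- After x_{kp} r_{ijk} is traded for x_{ij} r_{ikp}, the index j no longer occurs in the basis
element, so x_{jq} r_{ikp} is itself in ℬ: by `h₅` if q = k, `h₄` if q = p, and `h₈` otherwise. -/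
theorem mul_smul_r_mem {i j k p q : Fin n} (hpk : p < k) (hqk : q ≤ k) (hkj : k < j)
    (hji : j < i) : (x j q * x k p) • r i j k ∈ Submodule.span (S n) (setB n) := by
  have h₁ := Submodule.smul_mem _ (x j q) (smul_r_sub_mem hpk hkj hji)
  have h₂ : x j q • r i k p ∈ Submodule.span (S n) (setB n) := by
    rcases eq_or_lt_of_le hqk with rfl | hqk
    · exact (MemB.h₅ (hkj := hpk) (hji := hkj.trans hji) j hkj hji).mem_span
    · rcases eq_or_ne q p with rfl | hqp
      · exact (MemB.h₄ (hkj := hpk) (hji := hkj.trans hji) j hkj hji).mem_span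
      · refine (MemB.h₈ (hkj := hpk) (hji := hkj.trans hji) j q (by order) ?_).mem_span
        ext y
        simp only [Set.mem_inter_iff, Set.mem_insert_iff, Set.mem_singleton_iff,
          Set.mem_empty_iff_false, iff_false]
        omega
  convert Submodule.add_mem _ h₁ (Submodule.smul_mem _ (x i j) h₂) using 1
  module

theorem mul_smul_r_mem' {i j k p q : Fin n} (hpk : p < k) (hqk : q < k) (hkj : k < j)
    (hji : j < i) : (x i q * x k p) • r i j k ∈ Submodule.span (S n) (setB n) := by
  have h₁ := Submodule.smul_mem _ (x i q) (smul_r_add_mem hpk hkj hji)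
  have h₂ : x i q • r j k p ∈ Submodule.span (S n) (setB n) := by
    rcases eq_or_ne q p with rfl | hqp
    · exact (MemB.h₆ (hkj := hpk) (hji := hkj) i hji).mem_span
    · refine (MemB.h₈ (hkj := hpk) (hji := hkj) i q (by order) ?_).mem_span
      ext y
      simp only [Set.mem_inter_iff, Set.mem_insert_iff, Set.mem_singleton_iff,
        Set.mem_empty_iff_false, iff_false]
      omega
  convert Submodule.sub_mem _ h₁ (Submodule.smul_mem _ (x i j) h₂) using 1
  module

theorem MemD.mem_span {i j k : Fin n} {hkj : k < j} {hji : j < i} {f : F n}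
    (h : MemD i j k hkj hji f) : f ∈ Submodule.span (S n) (setB n) := by
  cases h with
  | h₉ l p hpl hlk =>
    -- In x_{kp}(x_{il} + x_{jl} + x_{kl}) r_{ijk} the first two products are already known to lie
    -- in the span.
    have h₁ := Submodule.smul_mem _ (x k p)
      (MemB.h₁ (hkj := hkj) (hji := hji) l hlk).mem_span
    have h₂ := mul_smul_r_mem (hpl.trans_lt hlk) hlk.le hkj hji
    have h₃ := mul_smul_r_mem' (hpl.trans_lt hlk) hlk hkj hji
    convert Submodule.sub_mem _ h₁ (Submodule.add_mem _ h₂ h₃) using 1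
    module
  | h₀ q p hqk hpk => exact mul_smul_r_mem hpk hqk hkj hji

theorem span_setG (n : ℕ) :
    Submodule.span (S n) (setG n) = Submodule.span (S n) (setB n) := by
  refine le_antisymm (Submodule.span_le.2 ?_) (Submodule.span_mono ?_)
  · rintro f ⟨i, j, k, hkj, hji, h | h⟩
    · exact h.mem_span
    · exact h.mem_span
  · rintro f ⟨i, j, k, hkj, hji, h⟩
    exact ⟨i, j, k, hkj, hji, Or.inl h⟩

/-! ### Finiteness of 𝒢 -/

theorem setOf_memB_subset {i j k : Fin n} (hkj : k < j) (hji : j < i) :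
    {f | MemB i j k hkj hji f} ⊆ {f |
      (∃ (l : Fin n) (_ : k < l) (_ : l < j),
        f = (-x j k - x l k) • r i j l + x j l • r i j k) ∨
      (∃ (l : Fin n) (_ : k < l) (_ : l < j), f = x j k • r i j l + x i l • r i j k) ∨
      (∃ (l : Fin n) (_ : j < l) (_ : l < i), f = -x j k • r i l j + x i l • r i j k) ∨
      (∃ (l : Fin n) (_ : i < l), f = x j k • r l i j + x l i • r i j k) ∨
      (∃ (l : Fin n) (_ : l < k), f = (x i l + x j l + x k l) • r i j k) ∨
      f = (x i k + x j k) • r i j k ∨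
      (∃ (s t : Fin n) (_ : t < s), f = x s t • r i j k)} := by
  intro f h
  cases h with
  | g₁ l h h' => exact .inl ⟨l, h, h', rfl⟩
  | g₂ l h h' => exact .inr (.inl ⟨l, h, h', rfl⟩)
  | g₃ l h h' => exact .inr (.inr (.inl ⟨l, h, h', rfl⟩))
  | g₄ l h => exact .inr (.inr (.inr (.inl ⟨l, h, rfl⟩)))
  | h₁ l h => exact .inr (.inr (.inr (.inr (.inl ⟨l, h, rfl⟩))))
  | h₂ => exact .inr (.inr (.inr (.inr (.inr (.inl rfl)))))
  | h₃ l h h' => exact .inr (.inr (.inr (.inr (.inr (.inr ⟨l, k, h, rfl⟩)))))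
  | h₄ l h h' => exact .inr (.inr (.inr (.inr (.inr (.inr ⟨l, k, hkj.trans h, rfl⟩)))))
  | h₅ l h h' => exact .inr (.inr (.inr (.inr (.inr (.inr ⟨l, j, h, rfl⟩)))))
  | h₆ l h => exact .inr (.inr (.inr (.inr (.inr (.inr ⟨l, k, (hkj.trans hji).trans h, rfl⟩)))))
  | h₇ l h => exact .inr (.inr (.inr (.inr (.inr (.inr ⟨l, j, hji.trans h, rfl⟩)))))
  | h₈ s t h h' => exact .inr (.inr (.inr (.inr (.inr (.inr ⟨s, t, h, rfl⟩)))))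

theorem finite_setOf_memB {i j k : Fin n} (hkj : k < j) (hji : j < i) :
    {f | MemB i j k hkj hji f}.Finite := by
  refine Set.Finite.subset ?_ (setOf_memB_subset hkj hji)
  simp only [Set.ofPred_or, Set.ofPred_exists, Set.finite_union]
  refine ⟨?_, ?_, ?_, ?_, ?_, ?_, ?_⟩ <;>
    repeat first | exact Set.finite_singleton _ | refine Set.finite_iUnion fun _ => ?_

theorem finite_setOf_memD {i j k : Fin n} (hkj : k < j) (hji : j < i) :
    {f | MemD i j k hkj hji f}.Finite := by
  have h : {f | MemD i j k hkj hji f} ⊆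
      {f | (∃ (l p : Fin n) (_ : p ≤ l) (_ : l < k), f = (x k l * x k p) • r i j k) ∨
        ∃ (q p : Fin n) (_ : q ≤ k) (_ : p < k), f = (x j q * x k p) • r i j k} := by
    rintro f (⟨l, p, h, h'⟩ | ⟨q, p, h, h'⟩)
    · exact .inl ⟨l, p, h, h', rfl⟩
    · exact .inr ⟨q, p, h, h', rfl⟩
  refine Set.Finite.subset ?_ h
  simp only [Set.ofPred_or, Set.ofPred_exists, Set.finite_union]
  constructor <;>
    repeat first | exact Set.finite_singleton _ | refine Set.finite_iUnion fun _ => ?_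

theorem finite_setG (n : ℕ) : (setG n).Finite := by
  simp only [setG, Set.ofPred_exists]
  refine Set.finite_iUnion fun i => Set.finite_iUnion fun j => Set.finite_iUnion fun k =>
    Set.finite_iUnion fun hkj => Set.finite_iUnion fun hji => ?_
  exact (finite_setOf_memB hkj hji).union (finite_setOf_memD hkj hji)

/-! ### Substitutions triangular for the monomial order -/

theorem grevlexLT_add_left {α β : Pair n →₀ ℕ} (h : grevlexLT β α) (γ : Pair n →₀ ℕ) :
    grevlexLT (γ + β) (γ + α) := by
  rcases h with h | ⟨h, v, hv, hw⟩
  · exact Or.inl (by simpa [map_add] using h)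
  · refine Or.inr ⟨by simpa [map_add] using h, v, by simpa using hv, fun w hwv => ?_⟩
    simpa using hw w hwv

theorem grevlexLT_single {v w : Pair n} (h : varLT v w) :
    grevlexLT (Finsupp.single v 1) (Finsupp.single w 1) := by
  have hne : v ≠ w := by rintro rfl; exact varLT_irrefl _ h
  refine Or.inr ⟨by simp, v, by simp [hne.symm], fun u hu => ?_⟩
  have h₁ : v ≠ u := by rintro rfl; exact varLT_irrefl _ hu
  have h₂ : w ≠ u := by rintro rfl; exact varLT_irrefl _ (varLT_trans h hu)
  simp [h₁, h₂]

theorem mul_triangular {γ γ' : Pair n →₀ ℕ} {p q : S n}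
    (hp : p = monomial γ 1 ∨ p = 0 ∨ ∃ δ c, grevlexLT δ γ ∧ p = monomial δ c)
    (hq : q = monomial γ' 1 ∨ q = 0 ∨ ∃ δ c, grevlexLT δ γ' ∧ q = monomial δ c) :
    p * q = monomial γ 1 * monomial γ' 1 ∨ p * q = 0 ∨
      ∃ δ c, grevlexLT δ (γ + γ') ∧ p * q = monomial δ c := by
  rcases hp with rfl | rfl | ⟨δ, c, hlt, rfl⟩
  · rcases hq with rfl | rfl | ⟨δ', c', hlt', rfl⟩
    · exact .inl rfl
    · exact .inr (.inl (mul_zero _))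
    · exact .inr (.inr ⟨γ + δ', _, grevlexLT_add_left hlt' _, monomial_mul⟩)
  · exact .inr (.inl (zero_mul _))
  · have h : grevlexLT (δ + γ') (γ + γ') := by
      rw [add_comm δ, add_comm γ]
      exact grevlexLT_add_left hlt _
    rcases hq with rfl | rfl | ⟨δ', c', hlt', rfl⟩
    · exact .inr (.inr ⟨δ + γ', _, h, monomial_mul⟩)
    · exact .inr (.inl (mul_zero _))
    · exact .inr (.inr ⟨δ + δ', _, grevlexLT_trans (grevlexLT_add_left hlt' _) h, monomial_mul⟩)

/-- Under a substitution sending each variable to itself, to zero, or to a multiple of a smaller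
variable, a monomial is mapped to itself, to zero, or to a multiple of a smaller monomial. -/
theorem map_monomial_of_triangular (θ : S n →ₐ[ℂ] S n)
    (hθ : ∀ v, θ (X v) = X v ∨ θ (X v) = 0 ∨ ∃ w c, varLT w v ∧ θ (X v) = C c * X w)
    (γ : Pair n →₀ ℕ) :
    θ (monomial γ 1) = monomial γ 1 ∨ θ (monomial γ 1) = 0 ∨
      ∃ δ c, grevlexLT δ γ ∧ θ (monomial γ 1) = monomial δ c := by
  induction γ using Finsupp.induction_linear with
  | zero => left; simp
  | add γ γ' h h' =>
    have hm : (monomial (γ + γ') 1 : S n) = monomial γ 1 * monomial γ' 1 := by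
      simp [monomial_mul]
    rw [hm, map_mul]
    exact mul_triangular h h'
  | single v m =>
    induction m with
    | zero => left; simp
    | succ m ih =>
      have hm : (monomial (Finsupp.single v (m + 1)) 1 : S n) =
          monomial (Finsupp.single v m) 1 * X v := by
        rw [X, monomial_mul, ← Finsupp.single_add, one_mul]
      rw [hm, map_mul, X, Finsupp.single_add]
      refine mul_triangular ih ?_
      rcases hθ v with h | h | ⟨w, c, hlt, h⟩
      · exact .inl h
      · exact .inr (.inl h)
      · exact .inr (.inr ⟨_, c, grevlexLT_single hlt, h.trans (by rw [X, C_mul_monomial, mul_one])⟩)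

theorem map_monomial_of_fixed (θ : S n →ₐ[ℂ] S n) {α : Pair n →₀ ℕ}
    (hα : ∀ v, α v ≠ 0 → θ (X v) = X v) (c : ℂ) : θ (monomial α c) = monomial α c := by
  rw [monomial_eq, map_mul, algHom_C, Finsupp.prod, map_prod]
  congr 1
  refine Finset.prod_congr rfl fun v hv => ?_
  rw [map_pow, hα v (Finsupp.mem_support_iff.1 hv)]

theorem coeff_map_eq (θ : S n →ₐ[ℂ] S n) {α : Pair n →₀ ℕ}
    (hα : ∀ v, α v ≠ 0 → θ (X v) = X v) {p : S n}
    (hp : ∀ γ, coeff γ p ≠ 0 → γ ≠ α → coeff α (θ (monomial γ 1)) = 0) :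
    coeff α (θ p) = coeff α p := by
  classical
  have h1 : θ p = ∑ γ ∈ p.support, C (coeff γ p) * θ (monomial γ 1) := by
    conv_lhs => rw [p.as_sum, map_sum]
    refine Finset.sum_congr rfl fun γ _ => ?_
    conv_lhs => rw [← mul_one (coeff γ p), ← C_mul_monomial, map_mul, algHom_C, algebraMap_eq]
  rw [h1, coeff_sum]
  have h2 : ∀ γ ∈ p.support, γ ≠ α → coeff α (C (coeff γ p) * θ (monomial γ 1)) = 0 := by
    intro γ hγ hne
    rw [coeff_C_mul, hp γ (mem_support_iff.1 hγ) hne, mul_zero]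
  rw [Finset.sum_eq_single α h2]
  · rw [coeff_C_mul, map_monomial_of_fixed θ hα, coeff_monomial, if_pos rfl, mul_one]
  · intro h
    rw [notMem_support_iff.1 h]
    simp

/-- The leading monomial is fixed, and every smaller monomial goes to zero or to a multiple of a
monomial still below α, so nothing else contributes to the coefficient at α. -/
theorem coeff_map_of_triangular (θ : S n →ₐ[ℂ] S n)
    (hθ : ∀ v, θ (X v) = X v ∨ θ (X v) = 0 ∨ ∃ w c, varLT w v ∧ θ (X v) = C c * X w) {α : Pair n →₀ ℕ}
    (hα : ∀ v, α v ≠ 0 → θ (X v) = X v) {p : S n}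
    (hp : ∀ γ, coeff γ p ≠ 0 → γ ≠ α → grevlexLT γ α) :
    coeff α (θ p) = coeff α p := by
  classical
  refine coeff_map_eq θ hα fun γ hγ hne => ?_
  rcases map_monomial_of_triangular θ hθ γ with h | h | ⟨δ, c, hlt, h⟩
  · rw [h, coeff_monomial, if_neg hne]
  · rw [h, coeff_zero]
  · rw [h, coeff_monomial, if_neg]
    rintro rfl
    exact grevlexLT_irrefl _ (grevlexLT_trans hlt (hp γ hγ hne))

/-! ### Leading monomials in x_{ij} and x_{jq} -/

/-- The substitution `x_{jq} ↦ x_{jq}`, `x_{ij} ↦ x_{ij}`, `x_{iq} ↦ -x_{jq}` for `q < j`, and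
`x_{st} ↦ 0` otherwise. -/
noncomputable def localSubst (i j : Fin n) : S n →ₐ[ℂ] S n :=
  aeval fun v => if v.i = j ∨ (v.i = i ∧ v.j = j) then X v
    else if h : v.i = i ∧ v.j < j then -X ⟨j, v.j, h.2⟩ else 0

theorem localSubst_x_snd {i j q : Fin n} (hqj : q < j) : localSubst i j (x j q) = x j q := by
  simp [localSubst, x]

theorem localSubst_x_neg {i j q : Fin n} (hji : j < i) (hqj : q < j) :
    localSubst i j (x i q) = -x j q := by
  simp [localSubst, x, hji.ne', hqj.ne, hqj]

theorem localSubst_x_eq_zero {i j s t : Fin n} (hts : t < s) (hsj : s ≠ j)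
    (hst : s = i → j < t) : localSubst i j (x s t) = 0 := by
  have h₁ : ¬ (s = i ∧ t = j) := fun h => (hst h.1).ne' h.2
  have h₂ : ¬ (s = i ∧ t < j) := fun h => (hst h.1).not_gt h.2
  simp [localSubst, x, hsj, h₁, h₂]

/-- The additive map `F → S`, semilinear over `localSubst i j`, with `r_{ijk} ↦ x_{jk}` and all
other basis elements sent to zero. -/
noncomputable def localMap (i j : Fin n) : F n →+ S n :=
  Finsupp.liftAddHom fun T =>
    (AddMonoidHom.mulRight (if T.i = i ∧ T.j = j then x T.j T.k T.hkj else 0)).comp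
      (localSubst i j : S n →+ S n)

theorem localMap_single (i j : Fin n) (T : Triple n) (p : S n) :
    localMap i j (Finsupp.single T p) =
      localSubst i j p * if T.i = i ∧ T.j = j then x T.j T.k T.hkj else 0 := by
  simp [localMap]

theorem localMap_smul (i j : Fin n) (p : S n) (f : F n) :
    localMap i j (p • f) = localSubst i j p * localMap i j f := by
  induction f using Finsupp.induction_linear with
  | zero => simp
  | add f g hf hg => rw [smul_add, map_add, map_add, hf, hg, mul_add]
  | single T q => rw [Finsupp.smul_single, localMap_single, localMap_single, smul_eq_mul, map_mul,
      mul_assoc]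

theorem localMap_r {i j k : Fin n} (hkj : k < j) (hji : j < i) :
    localMap i j (r i j k) = x j k := by
  simp [r, localMap_single]

theorem localMap_r_eq_zero {i j a b c : Fin n} (hcb : c < b) (hba : b < a)
    (h : ¬ (a = i ∧ b = j)) : localMap i j (r a b c) = 0 := by
  simp [r, localMap_single, h]

theorem ne_of_inter_eq_empty {s t i j k : Fin n}
    (h : ({s, t} ∩ {i, j, k} : Set (Fin n)) = ∅) :
    (s ≠ i ∧ s ≠ j ∧ s ≠ k) ∧ t ≠ i ∧ t ≠ j ∧ t ≠ k := by
  have h₁ := Set.eq_empty_iff_forall_notMem.1 h s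
  have h₂ := Set.eq_empty_iff_forall_notMem.1 h t
  simp only [Set.mem_inter_iff, Set.mem_insert_iff, Set.mem_singleton_iff, true_or, or_true,
    true_and, not_or] at h₁ h₂
  exact ⟨h₁, h₂⟩

/-- For (a, b) = (i, j), relations `g₁` and `g₂` become x_{jl}x_{jk} - x_{jk}x_{jl} up to sign, and
in `h₁`, `h₂` the image -x_{jq} of x_{iq} cancels x_{jq}. Otherwise r_{ij*} can occur only in `g₃`
or `g₄`, with coefficient ±x_{bc} where b < j, which the substitution kills. -/
theorem localMap_eq_zero_of_memB {i j a b c : Fin n} {hcb : c < b} {hba : b < a} (hji : j < i)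
    {f : F n} (h : MemB a b c hcb hba f) : localMap i j f = 0 := by
  by_cases hab : a = i ∧ b = j
  · obtain ⟨rfl, rfl⟩ := hab
    cases h with
    | h₈ s t h h' =>
      have h'' := ne_of_inter_eq_empty h'
      simp (disch := omega) only [localMap_smul, localSubst_x_eq_zero, zero_mul]
    | _ =>
      simp (disch := omega) only [map_add, map_sub, map_neg, localMap_smul, localMap_r,
        localMap_r_eq_zero, localSubst_x_snd, localSubst_x_neg, localSubst_x_eq_zero]
      ring
  · cases h with
    | g₃ l h h' =>
      by_cases hl : a = i ∧ l = j <;>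
        simp (disch := omega) only [map_add, localMap_smul, map_neg, localMap_r_eq_zero,
          localSubst_x_eq_zero] <;> ring
    | g₄ l h =>
      by_cases hl : l = i ∧ a = j <;>
        simp (disch := omega) only [map_add, localMap_smul, localMap_r_eq_zero,
          localSubst_x_eq_zero] <;> ring
    | _ =>
      simp (disch := omega) only [map_add, localMap_smul, localMap_r_eq_zero, mul_zero, add_zero]

theorem localMap_eq_zero {i j : Fin n} (hji : j < i) {f : F n}
    (hf : f ∈ Submodule.span (S n) (setB n)) : localMap i j f = 0 := by
  induction hf using Submodule.span_induction with
  | mem f h =>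
    obtain ⟨a, b, c, hcb, hba, h⟩ := h
    exact localMap_eq_zero_of_memB hji h
  | zero => exact map_zero _
  | add f g _ _ hf hg => rw [map_add, hf, hg, add_zero]
  | smul p f _ hf => rw [localMap_smul, hf, mul_zero]

theorem localMap_eq_sum (i j : Fin n) (f : F n) : localMap i j f =
    f.sum fun T p => localSubst i j p * if T.i = i ∧ T.j = j then x T.j T.k T.hkj else 0 := by
  conv_lhs => rw [← Finsupp.sum_single f, Finsupp.sum, map_sum]
  simp only [localMap_single, Finsupp.sum]

theorem localSubst_triangular {i j : Fin n} (hji : j < i) (v : Pair n) :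
    localSubst i j (X v) = X v ∨ localSubst i j (X v) = 0 ∨
      ∃ w c, varLT w v ∧ localSubst i j (X v) = C c * X w := by
  by_cases h₁ : v.i = j ∨ (v.i = i ∧ v.j = j)
  · left; simp [localSubst, h₁]
  by_cases h₂ : v.i = i ∧ v.j < j
  · refine .inr (.inr ⟨⟨j, v.j, h₂.2⟩, -1, .inl (by simpa [h₂.1] using hji), ?_⟩)
    simp only [localSubst, aeval_X, if_neg h₁, dif_pos h₂, map_neg, map_one, neg_one_mul]
  · exact .inr (.inl (by simp only [localSubst, aeval_X, if_neg h₁, dif_neg h₂]))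

theorem eq_zero_of_basisLT_leading {T s : Triple n} {α : Pair n →₀ ℕ} {f : F n}
    (hlt : ∀ s β, coeff β (f s) ≠ 0 → (s, β) ≠ (T, α) → posGrevlexLT (s, β) (T, α))
    (h : basisLT T s) : f s = 0 := by
  ext β
  by_contra hβ
  have hne : s ≠ T := by rintro rfl; exact basisLT_irrefl _ h
  rcases hlt s β hβ (by simp [hne]) with h' | h'
  · exact basisLT_irrefl _ (basisLT_trans h h')
  · exact hne h'.1

theorem grevlexLT_of_leading {T : Triple n} {α β : Pair n →₀ ℕ} {f : F n}
    (hlt : ∀ s β, coeff β (f s) ≠ 0 → (s, β) ≠ (T, α) → posGrevlexLT (s, β) (T, α))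
    (hβ : coeff β (f T) ≠ 0) (hne : β ≠ α) : grevlexLT β α := by
  rcases hlt T β hβ (by simp [hne]) with h | h
  · exact absurd h (basisLT_irrefl _)
  · exact h.2

/-- A leading monomial at `r_{ijk}` of an element of the span of `ℬ` is not supported on the
variables `x_{ij}` and `x_{jq}`, `q ≤ k`. -/
theorem exists_of_leading {T : Triple n} {α : Pair n →₀ ℕ} {f : F n}
    (hf : f ∈ Submodule.span (S n) (setB n)) (hα : coeff α (f T) ≠ 0)
    (hlt : ∀ s β, coeff β (f s) ≠ 0 → (s, β) ≠ (T, α) → posGrevlexLT (s, β) (T, α)) :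
    ∃ v, α v ≠ 0 ∧ ¬ (v.i = T.i ∧ v.j = T.j) ∧ ¬ (v.i = T.j ∧ v.j ≤ T.k) := by
  classical
  by_contra! hc
  obtain ⟨i, j, k, hkj, hji⟩ := T
  -- The image of f is the sum over m of θ(f_{ijm}) x_{jm}, with θ the substitution; its coefficient
  -- at x^α x_{jk} is compared with that of f_{ijk} at x^α.
  have h0 := congrArg (coeff (α + Finsupp.single ⟨j, k, hkj⟩ 1)) (localMap_eq_zero hji hf)
  rw [localMap_eq_sum, Finsupp.sum, coeff_sum, Finset.sum_eq_single ⟨i, j, k, hkj, hji⟩] at h0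
  · simp only [and_self, if_true, x, coeff_mul_X, coeff_zero] at h0
    rw [coeff_map_of_triangular _ (localSubst_triangular hji)] at h0
    · exact hα h0
    · intro v hv
      have h : v.i = j ∨ (v.i = i ∧ v.j = j) := by
        by_cases h : v.i = i ∧ v.j = j
        · exact .inr h
        · exact .inl (hc v hv (by simpa using h)).1
      simp [localSubst, h]
    · exact fun γ hγ hne => grevlexLT_of_leading hlt hγ hne
  · intro s hs hne
    by_cases h : s.i = i ∧ s.j = j
    · obtain ⟨a, b, m, hmb, hba⟩ := s
      obtain ⟨rfl, rfl⟩ := h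
      -- For m < k the basis element r_{ijm} exceeds the leading one, so its coefficient vanishes.
      have hkm : k < m := by
        rcases lt_trichotomy k m with h | rfl | h
        · exact h
        · exact absurd rfl hne
        · exact absurd (eq_zero_of_basisLT_leading (s := ⟨a, b, m, hmb, hba⟩) hlt
            (.inr (.inr ⟨rfl, rfl, h⟩)))
            (Finsupp.mem_support_iff.1 hs)
      -- For m > k the monomial x^α x_{jk} is not divisible by x_{jm}.
      have hαm : α ⟨b, m, hmb⟩ = 0 := by
        by_contra h
        exact (hc _ h (fun h' => absurd h' hji.ne)).2.not_gt hkm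
      simp [x, coeff_mul_X', hαm, hkm.ne]
    · simp [h]
  · intro h
    rw [Finsupp.notMem_support_iff.1 h] at hα
    exact absurd (coeff_zero _) hα

/-! ### Leading monomials x_{ij}^m x_{kp} -/

open Classical in
/-- The substitution setting all variables except `X v` to zero. -/
noncomputable def edgeSubst (v : Pair n) : S n →ₐ[ℂ] S n :=
  aeval fun w => if w = v then X w else 0

theorem edgeSubst_x {s t u w : Fin n} (hts : t < s) (hwu : w < u) (h : s = u ∧ t = w) :
    edgeSubst ⟨u, w, hwu⟩ (x s t) = X ⟨u, w, hwu⟩ := by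
  obtain ⟨rfl, rfl⟩ := h
  simp [edgeSubst, x]

theorem edgeSubst_x_eq_zero {s t u w : Fin n} (hts : t < s) (hwu : w < u)
    (h : ¬ (s = u ∧ t = w)) : edgeSubst ⟨u, w, hwu⟩ (x s t) = 0 := by
  simp [edgeSubst, x, h]

theorem pderiv_x {s t u w : Fin n} (hts : t < s) (hwu : w < u) (h : s = u ∧ t = w) :
    pderiv ⟨u, w, hwu⟩ (x s t) = 1 := by
  obtain ⟨rfl, rfl⟩ := h
  exact pderiv_X_self _

theorem pderiv_x_eq_zero {s t u w : Fin n} (hts : t < s) (hwu : w < u)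
    (h : ¬ (s = u ∧ t = w)) : pderiv ⟨u, w, hwu⟩ (x s t) = 0 := by
  refine pderiv_X_of_ne fun h' => h ?_
  simpa using h'

theorem r_apply {i j k a b c : Fin n} (hkj : k < j) (hji : j < i) (hcb : c < b) (hba : b < a)
    (h : i = a ∧ j = b ∧ k = c) : (r i j k : F n) ⟨a, b, c, hcb, hba⟩ = 1 := by
  obtain ⟨rfl, rfl, rfl⟩ := h
  simp [r]

theorem r_apply_eq_zero {i j k a b c : Fin n} (hkj : k < j) (hji : j < i) (hcb : c < b)
    (hba : b < a) (h : ¬ (i = a ∧ j = b ∧ k = c)) :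
    (r i j k : F n) ⟨a, b, c, hcb, hba⟩ = 0 := by
  refine Finsupp.single_eq_of_ne fun h' => h ?_
  simpa [eq_comm] using h'

section Quadruple

variable {a b c d : Fin n} (hab : a < b) (hbc : b < c) (hcd : c < d)

/-- An additive map `F → S` detecting `x_{ba} r_{dcb} = x_{dc} r_{dba} = -x_{dc} r_{cba}`. -/
noncomputable def quadMap (f : F n) : S n :=
  X ⟨d, c, hcd⟩ * (edgeSubst ⟨d, c, hcd⟩ (pderiv ⟨b, a, hab⟩ (f ⟨d, c, b, hbc, hcd⟩)) -
      edgeSubst ⟨d, c, hcd⟩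
        (pderiv ⟨d, a, (hab.trans hbc).trans hcd⟩ (f ⟨d, c, b, hbc, hcd⟩)) +
      edgeSubst ⟨d, c, hcd⟩
        (pderiv ⟨c, b, hbc⟩ (f ⟨d, c, a, hab.trans hbc, hcd⟩))) +
    edgeSubst ⟨d, c, hcd⟩ (f ⟨d, b, a, hab, hbc.trans hcd⟩) -
    edgeSubst ⟨d, c, hcd⟩ (f ⟨c, b, a, hab, hbc⟩)

/-- The joint kernel of `quadMap` and of the evaluations of the coefficients at `r_{dcb}` and
`r_{dca}` along `edgeSubst`. -/
def QuadKernel (f : F n) : Prop :=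
  quadMap hab hbc hcd f = 0 ∧ edgeSubst ⟨d, c, hcd⟩ (f ⟨d, c, b, hbc, hcd⟩) = 0 ∧
    edgeSubst ⟨d, c, hcd⟩ (f ⟨d, c, a, hab.trans hbc, hcd⟩) = 0

theorem QuadKernel.add {f g : F n} (hf : QuadKernel hab hbc hcd f)
    (hg : QuadKernel hab hbc hcd g) : QuadKernel hab hbc hcd (f + g) := by
  obtain ⟨h₁, h₂, h₃⟩ := hf
  obtain ⟨h₁', h₂', h₃'⟩ := hg
  simp only [QuadKernel, quadMap, Finsupp.add_apply, map_add] at *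
  refine ⟨?_, by rw [h₂, h₂', add_zero], by rw [h₃, h₃', add_zero]⟩
  linear_combination h₁ + h₁'

/-- By the Leibniz rule `quadMap` is semilinear only up to terms containing the restrictions of
f_{dcb} and f_{dca}; this is why `QuadKernel` requires these to vanish as well. -/
theorem QuadKernel.smul {f : F n} (hf : QuadKernel hab hbc hcd f) (p : S n) :
    QuadKernel hab hbc hcd (p • f) := by
  obtain ⟨h₁, h₂, h₃⟩ := hf
  simp only [QuadKernel, quadMap, Finsupp.smul_apply, smul_eq_mul, map_mul, Derivation.leibniz,
    map_add] at *
  refine ⟨?_, by rw [h₂, mul_zero], by rw [h₃, mul_zero]⟩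
  rw [h₂, h₃]
  linear_combination edgeSubst ⟨d, c, hcd⟩ p * h₁

theorem quad_cases (a b c d i j k : Fin n) :
    (i = d ∧ j = c ∧ k = b) ∨ (i = d ∧ j = c ∧ k = a) ∨ (i = d ∧ j = b ∧ k = a) ∨
      (i = c ∧ j = b ∧ k = a) ∨ (¬ (i = d ∧ j = c ∧ k = b) ∧ ¬ (i = d ∧ j = c ∧ k = a) ∧
        ¬ (i = d ∧ j = b ∧ k = a) ∧ ¬ (i = c ∧ j = b ∧ k = a)) := by
  tauto

set_option maxHeartbeats 4000000 in
-- Four relations meet `quadMap` in nonzero terms that must cancel. `g₃` and `g₄` pair x_{ba}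
-- r_{dcb} with x_{dc} r_{dba} and x_{dc} r_{cba}. The derivative along x_{da} balances `h₁` at
-- r_{dcb}, and the one along x_{cb} balances `g₁` at r_{dca}.
theorem QuadKernel.of_memB {i j k : Fin n} {hkj : k < j} {hji : j < i} {f : F n}
    (h : MemB i j k hkj hji f) : QuadKernel hab hbc hcd f := by
  cases h
  case' g₁ l h h' => rcases quad_cases a b c d i j l with h₀ | h₀ | h₀ | h₀ | h₀
  case' g₂ l h h' => rcases quad_cases a b c d i j l with h₀ | h₀ | h₀ | h₀ | h₀
  case' g₃ l h h' => rcases quad_cases a b c d i l j with h₀ | h₀ | h₀ | h₀ | h₀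
  case' g₄ l h => rcases quad_cases a b c d l i j with h₀ | h₀ | h₀ | h₀ | h₀
  case' h₁ l h => rcases eq_or_ne l a with hl | hl
  case' h₈ s t h h' => have h₀ := ne_of_inter_eq_empty h'
  all_goals
    rcases quad_cases a b c d i j k with key | key | key | key | key <;>
    first
    | (exfalso; omega)
    | (refine ⟨?_, ?_, ?_⟩ <;>
      simp (disch := omega) only [quadMap, Finsupp.add_apply, Finsupp.smul_apply,
        smul_eq_mul, map_add, map_sub, map_neg, map_zero, map_one, mul_zero, mul_one, r_apply, r_apply_eq_zero, edgeSubst_x,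
        edgeSubst_x_eq_zero, pderiv_x, pderiv_x_eq_zero] <;> ring)

end Quadruple

theorem coeff_edgeSubst (v : Pair n) (m : ℕ) (p : S n) :
    coeff (Finsupp.single v m) (edgeSubst v p) = coeff (Finsupp.single v m) p := by
  classical
  refine coeff_map_eq _ (fun w hw => ?_) fun γ _ hne => ?_
  · have h : w = v := by
      by_contra h
      exact hw (Finsupp.single_eq_of_ne h)
    simp [edgeSubst, h]
  · by_cases h : ∃ w, γ w ≠ 0 ∧ w ≠ v
    · obtain ⟨w, hw, hwv⟩ := h
      have hγ : γ = γ - Finsupp.single w 1 + Finsupp.single w 1 :=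
        (tsub_add_cancel_of_le (by simpa [Nat.one_le_iff_ne_zero] using hw)).symm
      have hX : edgeSubst v (X w : S n) = 0 := by simp [edgeSubst, hwv]
      rw [hγ, ← mul_one (1 : ℂ), ← monomial_mul, map_mul]
      change coeff _ (_ * edgeSubst v (X w)) = 0
      rw [hX, mul_zero, coeff_zero]
    · push Not at h
      rw [map_monomial_of_fixed, coeff_monomial, if_neg hne]
      intro w hw
      simp [edgeSubst, h w hw]

section Quadruple

variable {a b c d : Fin n} (hab : a < b) (hbc : b < c) (hcd : c < d)

theorem quadMap_eq_zero {f : F n} (hf : f ∈ Submodule.span (S n) (setB n)) :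
    quadMap hab hbc hcd f = 0 := by
  suffices h : QuadKernel hab hbc hcd f from h.1
  induction hf using Submodule.span_induction with
  | mem f h =>
    obtain ⟨i, j, k, hkj, hji, h⟩ := h
    exact QuadKernel.of_memB hab hbc hcd h
  | zero => simp [QuadKernel, quadMap]
  | add f g _ _ hf hg => exact hf.add hab hbc hcd hg
  | smul p f _ hf => exact hf.smul hab hbc hcd p

/-- The monomial `x_{dc}^m x_{ba} r_{dcb}` does not lead an element of the span of `ℬ`. -/
theorem coeff_eq_zero_of_leading {m : ℕ} {f : F n}
    (hf : f ∈ Submodule.span (S n) (setB n))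
    (hlt : ∀ s β, coeff β (f s) ≠ 0 → (s, β) ≠ (⟨d, c, b, hbc, hcd⟩,
        Finsupp.single ⟨d, c, hcd⟩ m + Finsupp.single ⟨b, a, hab⟩ 1) →
      posGrevlexLT (s, β) (⟨d, c, b, hbc, hcd⟩,
        Finsupp.single ⟨d, c, hcd⟩ m + Finsupp.single ⟨b, a, hab⟩ 1)) :
    coeff (Finsupp.single ⟨d, c, hcd⟩ m + Finsupp.single ⟨b, a, hab⟩ 1)
      (f ⟨d, c, b, hbc, hcd⟩) = 0 := by
  have h₁ : f ⟨d, c, a, hab.trans hbc, hcd⟩ = 0 :=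
    eq_zero_of_basisLT_leading hlt (.inr (.inr ⟨rfl, rfl, hab⟩))
  have h₂ : f ⟨d, b, a, hab, hbc.trans hcd⟩ = 0 :=
    eq_zero_of_basisLT_leading hlt (.inr (.inl ⟨rfl, hbc⟩))
  have h₃ : f ⟨c, b, a, hab, hbc⟩ = 0 := eq_zero_of_basisLT_leading hlt (.inl hcd)
  have h := quadMap_eq_zero hab hbc hcd hf
  simp only [quadMap, h₁, h₂, h₃, map_zero, add_zero, sub_zero] at h
  -- The three larger basis elements have coefficient zero, so only the two derivatives of f_{dcb}
  -- remain and the factor x_{dc} cancels.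
  rw [mul_eq_zero, or_iff_right (X_ne_zero _)] at h
  have h' := congrArg (coeff (Finsupp.single ⟨d, c, hcd⟩ m)) h
  -- Since x_{da} ≻ x_{ba}, this monomial would exceed the leading one.
  have hd : coeff (Finsupp.single ⟨d, c, hcd⟩ m +
      Finsupp.single ⟨d, a, (hab.trans hbc).trans hcd⟩ 1) (f ⟨d, c, b, hbc, hcd⟩) = 0 := by
    by_contra hc
    have hv : varLT ⟨b, a, hab⟩ ⟨d, a, (hab.trans hbc).trans hcd⟩ := .inl (hbc.trans hcd)
    have hg := grevlexLT_add_left (grevlexLT_single hv) (Finsupp.single ⟨d, c, hcd⟩ m)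
    have hne : Finsupp.single (⟨d, c, hcd⟩ : Pair n) m +
        Finsupp.single ⟨d, a, (hab.trans hbc).trans hcd⟩ 1 ≠
        Finsupp.single ⟨d, c, hcd⟩ m + Finsupp.single ⟨b, a, hab⟩ 1 := fun he =>
      grevlexLT_irrefl _ (he ▸ hg)
    exact grevlexLT_irrefl _ (grevlexLT_trans hg (grevlexLT_of_leading hlt hc hne))
  have hne : (⟨b, a, hab⟩ : Pair n) ≠ ⟨d, c, hcd⟩ := by
    simp [(hbc.trans hcd).ne]
  rw [coeff_sub, coeff_edgeSubst, coeff_edgeSubst, coeff_pderiv, coeff_pderiv, hd,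
    Finsupp.single_eq_of_ne hne] at h'
  simpa using h'

end Quadruple

/-! ### Initial terms of the elements of 𝒢 -/

theorem isInitialTerm_add {T : Triple n} {α : Pair n →₀ ℕ} {h : F n} {q : S n}
    (hh : ∀ s, h s ≠ 0 → basisLT s T) (hq : ∀ β, coeff β q ≠ 0 → grevlexLT β α) :
    (posGrevlex n).IsInitialTerm (h + (monomial α 1 + q) • Finsupp.single T 1)
      (Finsupp.single T (monomial α 1)) := by
  classical
  have hT : h T = 0 := by
    by_contra hc
    exact basisLT_irrefl _ (hh T hc)
  have hα : coeff α q = 0 := by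
    by_contra hc
    exact grevlexLT_irrefl _ (hq α hc)
  have hfT : (h + (monomial α 1 + q) • Finsupp.single T 1 : F n) T = monomial α 1 + q := by
    simp [hT]
  have hc : coeff α (monomial α (1 : ℂ) + q) = 1 := by simp [hα]
  refine ⟨T, α, ?_, fun s β hβ hne => ?_, ?_⟩
  · rw [hfT, hc]
    exact one_ne_zero
  · rcases eq_or_ne s T with rfl | hs
    · have hβα : α ≠ β := by rintro rfl; exact hne rfl
      rw [hfT, coeff_add, coeff_monomial, if_neg hβα, zero_add] at hβ
      exact .inr ⟨rfl, hq β hβ⟩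
    · refine .inl (hh s fun h0 => hβ ?_)
      simp [h0, hs.symm]
  · rw [hfT, hc]

theorem isInitialTerm_monomial (T : Triple n) (α : Pair n →₀ ℕ) :
    (posGrevlex n).IsInitialTerm ((monomial α 1 : S n) • (Finsupp.single T 1 : F n))
      (Finsupp.single T (monomial α 1)) := by
  have h := isInitialTerm_add (T := T) (α := α) (h := 0) (q := 0) (by simp) (by simp)
  rwa [zero_add, add_zero] at h

theorem isInitialTerm_X (T : Triple n) (v : Pair n) :
    (posGrevlex n).IsInitialTerm ((X v : S n) • (Finsupp.single T 1 : F n))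
      (Finsupp.single T (X v)) :=
  isInitialTerm_monomial T _

theorem isInitialTerm_X_add {T : Triple n} {v : Pair n} {q : S n}
    (hq : ∀ β, coeff β q ≠ 0 → grevlexLT β (Finsupp.single v 1)) :
    (posGrevlex n).IsInitialTerm ((X v + q) • (Finsupp.single T 1 : F n))
      (Finsupp.single T (X v)) := by
  have h := isInitialTerm_add (T := T) (h := 0) (by simp) hq
  rwa [zero_add] at h

theorem isInitialTerm_smul_add_X {T T' : Triple n} {v : Pair n} (h : basisLT T' T) (p : S n) :
    (posGrevlex n).IsInitialTerm 
        (p • (Finsupp.single T' 1 : F n) + (X v : S n) • (Finsupp.single T 1 : F n))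
      (Finsupp.single T (X v)) := by
  have h' := isInitialTerm_add (T := T) (α := Finsupp.single v 1) (h := p • (Finsupp.single T' 1 : F n))
    (q := 0) ?_ (by simp)
  · rwa [add_zero] at h'
  · intro s hs
    rcases eq_or_ne s T' with rfl | hne
    · exact h
    · exact absurd (by rw [Finsupp.smul_apply, Finsupp.single_eq_of_ne hne, smul_zero]) hs

theorem grevlexLT_of_coeff_X_ne_zero {v w : Pair n} (h : varLT w v) {β : Pair n →₀ ℕ}
    (hβ : coeff β (X w : S n) ≠ 0) : grevlexLT β (Finsupp.single v 1) := by
  classical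
  rw [coeff_X] at hβ
  obtain rfl : Finsupp.single w 1 = β := by
    by_contra hc
    exact hβ (if_neg hc)
  exact grevlexLT_single h

/-- Every variable except `x_{ij}`, `x_{jq}` for `q ≤ k`, and `x_{kp}` gives an initial term at
`r_{ijk}` of an element of `ℬ`. -/
theorem exists_isInitialTerm_X (T : Triple n) (v : Pair n) (h₁ : ¬ (v.i = T.i ∧ v.j = T.j))
    (h₂ : ¬ (v.i = T.j ∧ v.j ≤ T.k)) (h₃ : v.i ≠ T.k) :
    ∃ g ∈ setG n, (posGrevlex n).IsInitialTerm g (Finsupp.single T (X v)) := by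
  obtain ⟨i, j, k, hkj, hji⟩ := T
  obtain ⟨s, t, hts⟩ := v
  dsimp only at h₁ h₂ h₃
  have mem : ∀ {f : F n}, MemB i j k hkj hji f → f ∈ setG n := fun h =>
    ⟨i, j, k, hkj, hji, .inl h⟩
  by_cases hsi : s = i
  · subst hsi
    rcases lt_trichotomy t k with htk | rfl | htk
    -- The first index dominates the variable order, so x_{it} exceeds both x_{jt} and x_{kt}.
    · refine ⟨_, mem (.h₁ t htk), ?_⟩
      rw [add_assoc]
      refine isInitialTerm_X_add fun β hβ => ?_
      by_cases h : coeff β (x j t : S n) = 0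
      · rw [coeff_add, h, zero_add] at hβ
        exact grevlexLT_of_coeff_X_ne_zero (.inl (hkj.trans hji)) hβ
      · exact grevlexLT_of_coeff_X_ne_zero (.inl hji) h
    · exact ⟨_, mem .h₂, isInitialTerm_X_add fun β hβ =>
        grevlexLT_of_coeff_X_ne_zero (.inl hji) hβ⟩
    · rcases lt_trichotomy t j with htj | rfl | htj
      · refine ⟨_, mem (.g₂ t htk htj), ?_⟩
        -- Larger indices make a basis element smaller, so r_{ijk} outranks r_{ijt} whatever the
        -- coefficient of the latter.
        refine isInitialTerm_smul_add_X ?_ _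
        exact (.inr (.inr ⟨rfl, rfl, htk⟩))
      · exact absurd ⟨rfl, rfl⟩ h₁
      · refine ⟨_, mem (.g₃ t htj hts), ?_⟩
        refine isInitialTerm_smul_add_X ?_ _
        exact (.inr (.inl ⟨rfl, htj⟩))
  by_cases hsj : s = j
  · subst hsj
    have htk : k < t := by omega
    refine ⟨_, mem (.g₁ t htk hts), ?_⟩
    refine isInitialTerm_smul_add_X ?_ _
    exact (.inr (.inr ⟨rfl, rfl, htk⟩))
  by_cases hti : t = i
  · subst hti
    refine ⟨_, mem (.g₄ s hts), ?_⟩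
    refine isInitialTerm_smul_add_X ?_ _
    exact (.inl hts)
  by_cases htj : t = j
  · subst htj
    rcases lt_or_gt_of_ne hsi with h | h
    · exact ⟨_, mem (.h₅ s hts h), isInitialTerm_X _ _⟩
    · exact ⟨_, mem (.h₇ s h), isInitialTerm_X _ _⟩
  by_cases htk : t = k
  · subst htk
    rcases lt_or_gt_of_ne hsj with h | h
    · exact ⟨_, mem (.h₃ s hts h), isInitialTerm_X _ _⟩
    · rcases lt_or_gt_of_ne hsi with h' | h'
      · exact ⟨_, mem (.h₄ s h h'), isInitialTerm_X _ _⟩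
      · exact ⟨_, mem (.h₆ s h'), isInitialTerm_X _ _⟩
  refine ⟨_, mem (.h₈ s t hts ?_), isInitialTerm_X _ _⟩
  ext y
  simp only [Set.mem_inter_iff, Set.mem_insert_iff, Set.mem_singleton_iff,
    Set.mem_empty_iff_false, iff_false]
  omega

theorem exists_isInitialTerm_X_mul_X (T : Triple n) {v w : Pair n} (hw : w.i = T.k)
    (hv : v.i = T.k ∨ (v.i = T.j ∧ v.j ≤ T.k)) :
    ∃ g ∈ setG n, (posGrevlex n).IsInitialTerm g
      (Finsupp.single T (monomial (Finsupp.single v 1 + Finsupp.single w 1) 1)) := by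
  obtain ⟨i, j, k, hkj, hji⟩ := T
  obtain ⟨s, p, hps⟩ := w
  obtain ⟨u, q, hqu⟩ := v
  have hmul : ∀ v w : Pair n,
      (X v * X w : S n) = monomial (Finsupp.single v 1 + Finsupp.single w 1) 1 := fun v w => by
    rw [X, X, monomial_mul, one_mul]
  dsimp only at hw hv
  subst hw
  rcases hv with rfl | ⟨rfl, hq⟩
  · rcases le_total p q with h | h
    · refine ⟨_, ⟨i, j, _, hkj, hji, .inr (.h₉ q p h hqu)⟩, ?_⟩
      rw [x, x, hmul]
      exact isInitialTerm_monomial _ _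
    · refine ⟨_, ⟨i, j, _, hkj, hji, .inr (.h₉ p q h hps)⟩, ?_⟩
      rw [x, x, hmul, add_comm]
      exact isInitialTerm_monomial _ _
  · refine ⟨_, ⟨i, _, _, hkj, hji, .inr (.h₀ q p hq hps)⟩, ?_⟩
    rw [x, x, hmul]
    exact isInitialTerm_monomial _ _

/-! ### Divisibility of leading monomials -/

/-- Every leading monomial of an element of the span of `ℬ` is divisible by the leading monomial
of an element of `𝒢`. -/
theorem exists_dvd_leading {T : Triple n} {α : Pair n →₀ ℕ} {f : F n}
    (hf : f ∈ Submodule.span (S n) (setB n)) (hα : coeff α (f T) ≠ 0)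
    (hlt : ∀ s β, coeff β (f s) ≠ 0 → (s, β) ≠ (T, α) → posGrevlexLT (s, β) (T, α)) :
    ∃ g ∈ setG n, ∃ β ≤ α, (posGrevlex n).IsInitialTerm g (Finsupp.single T (monomial β 1)) := by
  by_contra! hc
  have hlin : ∀ v : Pair n, α v ≠ 0 → ¬ (v.i = T.i ∧ v.j = T.j) → ¬ (v.i = T.j ∧ v.j ≤ T.k) →
      v.i = T.k := by
    intro v hv h₁ h₂
    by_contra h₃
    obtain ⟨g, hg, h⟩ := exists_isInitialTerm_X T v h₁ h₂ h₃
    exact hc g hg _ (by simpa [Nat.one_le_iff_ne_zero] using hv) h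
  -- Some variable of the leading monomial avoids x_{ij} and the x_{jq}; by the linear initial terms
  -- it is some x_{kp}.
  obtain ⟨w, hw, hw₁, hw₂⟩ := exists_of_leading hf hα hlt
  have hwk := hlin w hw hw₁ hw₂
  obtain ⟨γ, rfl⟩ : ∃ γ, α = γ + Finsupp.single w 1 := ⟨α - Finsupp.single w 1,
    (tsub_add_cancel_of_le (by simpa [Nat.one_le_iff_ne_zero] using hw)).symm⟩
  -- The quadratic initial terms forbid any other factor x_{kl} or x_{jq}, so the cofactor of x_{kp}
  -- is a power of x_{ij}.
  have hquad : ∀ v, γ v ≠ 0 → ¬ (v.i = T.k ∨ (v.i = T.j ∧ v.j ≤ T.k)) := by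
    intro v hv hv'
    obtain ⟨g, hg, h⟩ := exists_isInitialTerm_X_mul_X T hwk hv'
    refine hc g hg _ (add_le_add_left ?_ _) h
    simpa [Nat.one_le_iff_ne_zero] using hv
  have hsupp : ∀ v, v ≠ ⟨T.i, T.j, T.hji⟩ → γ v = 0 := by
    intro v hne
    by_contra hv
    have h := hquad v hv
    push Not at h
    exact h.1 (hlin v (by simp [hv]) (fun h' => hne (Pair.ext h'.1 h'.2))
      fun h' => (h.2 h'.1).not_ge h'.2)
  obtain ⟨m, rfl⟩ : ∃ m, γ = Finsupp.single ⟨T.i, T.j, T.hji⟩ m := by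
    refine ⟨γ ⟨T.i, T.j, T.hji⟩, Finsupp.ext fun v => ?_⟩
    rcases eq_or_ne v ⟨T.i, T.j, T.hji⟩ with rfl | hne
    · rw [Finsupp.single_eq_same]
    · rw [hsupp v hne, Finsupp.single_eq_of_ne hne]
  obtain ⟨i, j, k, hkj, hji⟩ := T
  obtain ⟨s, p, hps⟩ := w
  dsimp only at hwk
  subst hwk
  exact hα (coeff_eq_zero_of_leading hps hkj hji hf hlt)

theorem initialSubmodule_setG (n : ℕ) :
    (posGrevlex n).initialSubmodule (setG n) =
      (posGrevlex n).initialSubmodule (Submodule.span (S n) (setB n) : Set (F n)) := by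
  refine le_antisymm (Submodule.span_mono ?_) (Submodule.span_le.2 ?_)
  · rintro g ⟨f, hf, hg⟩
    exact ⟨f, span_setG n ▸ Submodule.subset_span hf, hg⟩
  · rintro _ ⟨f, hf, T, α, hα, hlt, rfl⟩
    obtain ⟨g, hg, β, hβ, h⟩ := exists_dvd_leading hf hα hlt
    have hm : (Finsupp.single T (monomial α (coeff α (f T))) : F n) =
        (monomial (α - β) (coeff α (f T)) : S n) • Finsupp.single T (monomial β 1) := by
      rw [Finsupp.smul_single, smul_eq_mul, monomial_mul, tsub_add_cancel_of_le hβ, mul_one]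
    rw [hm]
    exact Submodule.smul_mem _ _ (Submodule.subset_span ⟨g, hg, h⟩)

end UpperMcCool

theorem mainTheorem8 (n : ℕ) :
    (UpperMcCool.posGrevlex n).IsGroebnerBasis (UpperMcCool.setG n)
      (LinearMap.range (UpperMcCool.Psi n)) := by
  rw [UpperMcCool.range_Psi]
  exact ⟨UpperMcCool.finite_setG n, UpperMcCool.span_setG n, UpperMcCool.initialSubmodule_setG n⟩
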